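/- For real $\sigma,\tau$ let $\Phi(\sigma,\tau)=(\varphi_1,\varphi_2)\in\mathbf{C}^2$ with $$\varphi_1=e^{2\pi i\sigma}+e^{-2\pi i\sigma}+e^{2\pi i\tau}+e^{-2\pi i\tau},\qquad \varphi_2=e^{2\pi i(\sigma+\tau)}+e^{-2\pi i(\sigma+\tau)}+e^{2\pi i(\sigma-\tau)}+e^{2\pi i(\tau-\sigma)}$$ (the exponential sums over the Weyl group orbits of the two fundamental weights of the Lie algebra $B_2$). For an integer $k\ge 1$ let $\mathcal{B}_k$ be the bivariate folding polynomial map of $B_2$, i.e. the unique pair of polynomials in two variables with integer coefficients such that $\mathcal{B}_k(\Phi(\sigma,\tau))=\Phi(k\sigma,k\tau)$ for all $\sigma,\tau\in\mathbf{R}$. Let $q$ be a prime power and let $\bar{\mathcal{B}}_k:\mathbf{F}_q^2\to\mathbf{F}_q^2$ be the map induced by $\mathcal{B}_k$ over the finite field with $q$ elements. Put $$a=\frac{q-1}{\gcd(q-1,k)},\quad b=\frac{q+1}{\gcd(q+1,k)},\quad c=\frac{q^2-1}{\gcd(q^2-1,k)},\quad d=\frac{q^2+1}{\gcd(q^2+1,k)}.$$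 Then $$\left|\bar{\mathcal{B}}_k(\mathbf{F}_q^2)\right|=\frac{(a+b)^2}{8}+\frac{c+d}{4}+\eta(k,q),$$ where $$\eta(k,q)=\begin{cases}0 & \text{if } 2\nmid k \text{ or } 2\nmid c,\\ (a+b)/2+1/8 & \text{if } 2\mid k,\ 2\mid c \text{ and } 2\mid ab,\\ (a+b)/4+1/4 & \text{if } 2\mid k,\ 2\mid c \text{ and } 2\nmid ab.\end{cases}$$ -/

import Mathlib

namespace FoldingB2

open MvPolynomial

/-- The exponential sums over the orbits of the two fundamental weights under the Weyl group of
`B₂`, in the coordinates `σ, τ` in which the orbits are `{±σ, ±τ}` and `{±(σ+τ), ±(σ-τ)}`. -/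
noncomputable def Phi (σ τ : ℝ) : Fin 2 → ℂ :=
  ![Complex.exp (2 * Real.pi * Complex.I * σ) + Complex.exp (-2 * Real.pi * Complex.I * σ)
      + Complex.exp (2 * Real.pi * Complex.I * τ) + Complex.exp (-2 * Real.pi * Complex.I * τ),
    Complex.exp (2 * Real.pi * Complex.I * (σ + τ))
      + Complex.exp (-2 * Real.pi * Complex.I * (σ + τ))
      + Complex.exp (2 * Real.pi * Complex.I * (σ - τ))
      + Complex.exp (2 * Real.pi * Complex.I * (τ - σ))]

/-- The polynomial map over `R` induced on `R²` by a pair of integer polynomials in two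
variables. -/
noncomputable def inducedMap (R : Type*) [CommRing R] (P : Fin 2 → MvPolynomial (Fin 2) ℤ) :
    (Fin 2 → R) → (Fin 2 → R) :=
  fun v i => aeval v (P i)

/-- The functional equation `P(Φ(σ,τ)) = Φ(kσ,kτ)` that characterizes the `k`-th folding
polynomial map of `B₂`. -/
def IsFolding (k : ℕ) (P : Fin 2 → MvPolynomial (Fin 2) ℤ) : Prop :=
  ∀ σ τ : ℝ, inducedMap ℂ P (Phi σ τ) = Phi (k * σ) (k * τ)

/-- The power sums of four quantities `w, w⁻¹, z, z⁻¹` in terms of their elementary symmetric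
functions `e₁ = e₃` and `e₂`. -/
noncomputable def powerSum (e₁ e₂ : MvPolynomial (Fin 2) ℤ) : ℕ → MvPolynomial (Fin 2) ℤ
  | 0 => 4
  | 1 => e₁
  | 2 => e₁ ^ 2 - 2 * e₂
  | 3 => e₁ ^ 3 - 3 * e₁ * e₂ + 3 * e₁
  | (n + 4) => e₁ * powerSum e₁ e₂ (n + 3) - e₂ * powerSum e₁ e₂ (n + 2)
      + e₁ * powerSum e₁ e₂ (n + 1) - powerSum e₁ e₂ n

theorem aeval_powerSum {R : Type*} [CommRing R] (e₁ e₂ : MvPolynomial (Fin 2) ℤ) (v : Fin 2 → R)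
    (w w' z z' : R) (hw : w * w' = 1) (hz : z * z' = 1)
    (h₁ : aeval v e₁ = w + w' + z + z') (h₂ : aeval v e₂ = 2 + (w + w') * (z + z')) :
    ∀ k, aeval v (powerSum e₁ e₂ k) = w ^ k + w' ^ k + z ^ k + z' ^ k
  | 0 => by simp [powerSum]; norm_num
  | 1 => by simp [powerSum, h₁]
  | 2 => by
    simp only [powerSum, map_sub, map_pow, map_mul, h₁, h₂, map_ofNat]
    linear_combination 2 * hw + 2 * hz
  | 3 => by
    simp only [powerSum, map_sub, map_pow, map_mul, map_add, h₁, h₂, map_ofNat]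
    linear_combination 3 * (w + w') * hw + 3 * (z + z') * hz
  | (n + 4) => by
    simp only [powerSum, map_sub, map_mul, map_add, h₁, h₂,
      aeval_powerSum e₁ e₂ v w w' z z' hw hz h₁ h₂ (n + 3),
      aeval_powerSum e₁ e₂ v w w' z z' hw hz h₁ h₂ (n + 2),
      aeval_powerSum e₁ e₂ v w w' z z' hw hz h₁ h₂ (n + 1),
      aeval_powerSum e₁ e₂ v w w' z z' hw hz h₁ h₂ n]
    have key : ∀ t t' s s' : R, t * t' = 1 → s * s' = 1 →
        (t + t' + s + s') * t ^ (n + 3) - (2 + (t + t') * (s + s')) * t ^ (n + 2)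
          + (t + t' + s + s') * t ^ (n + 1) - t ^ n = t ^ (n + 4) := by
      intro t t' s s' h h'
      linear_combination (t ^ (n + 2) - (s + s') * t ^ (n + 1) + t ^ n) * h
    have a := key w w' z z' hw hz
    have b := key w' w z z' (by rw [mul_comm]; exact hw) hz
    have c := key z z' w w' hz hw
    have d := key z' z w w' (by rw [mul_comm]; exact hz) hw
    linear_combination a + b + c + d

/-- An explicit recursive form of the folding polynomials. -/
noncomputable def explicitFolding (k : ℕ) : Fin 2 → MvPolynomial (Fin 2) ℤ :=
  ![powerSum (X 0) (X 1 + 2) k, powerSum (X 1) (X 0 ^ 2 - 2 * X 1 - 2) k]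

theorem inducedMap_explicitFolding {R : Type*} [CommRing R] (k : ℕ) (w w' z z' : R)
    (hw : w * w' = 1) (hz : z * z' = 1) :
    inducedMap R (explicitFolding k) ![w + w' + z + z', w * z + w' * z' + w * z' + z * w'] =
      ![w ^ k + w' ^ k + z ^ k + z' ^ k,
        (w * z) ^ k + (w' * z') ^ k + (w * z') ^ k + (z * w') ^ k] := by
  funext i
  fin_cases i
  · simp only [inducedMap, explicitFolding]
    refine aeval_powerSum _ _ _ w w' z z' hw hz ?_ ?_ k
    · simp
    · simp; ring
  · simp only [inducedMap, explicitFolding]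
    refine aeval_powerSum _ _ _ (w * z) (w' * z') (w * z') (z * w') ?_ ?_ ?_ ?_ k
    · linear_combination z * z' * hw + hz
    · linear_combination z * z' * hw + hz
    · simp
    · simp
      linear_combination (2 - z ^ 2 - z' ^ 2) * hw + (2 - w ^ 2 - w' ^ 2) * hz

theorem Phi_eq (σ τ : ℝ) (w w' z z' : ℂ)
    (hw : w = Complex.exp (2 * Real.pi * Complex.I * σ))
    (hw' : w' = Complex.exp (-2 * Real.pi * Complex.I * σ))
    (hz : z = Complex.exp (2 * Real.pi * Complex.I * τ))
    (hz' : z' = Complex.exp (-2 * Real.pi * Complex.I * τ)) (k : ℕ) :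
    Phi (k * σ) (k * τ) = ![w ^ k + w' ^ k + z ^ k + z' ^ k,
        (w * z) ^ k + (w' * z') ^ k + (w * z') ^ k + (z * w') ^ k] := by
  subst hw hw' hz hz'
  have e : ∀ p q r s p' q' r' s' : ℂ, p = p' → q = q' → r = r' → s = s' →
      Complex.exp p + Complex.exp q + Complex.exp r + Complex.exp s =
      Complex.exp p' + Complex.exp q' + Complex.exp r' + Complex.exp s' := by
    rintro p q r s _ _ _ _ rfl rfl rfl rfl
    rfl
  simp only [Phi, ← Complex.exp_add, ← Complex.exp_nat_mul]
  push_cast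
  congr 1
  · apply e <;> ring
  · congr 1
    apply e <;> ring

theorem isFolding_explicitFolding (k : ℕ) : IsFolding k (explicitFolding k) := by
  intro σ τ
  rw [Phi_eq σ τ _ _ _ _ rfl rfl rfl rfl k]
  have h := Phi_eq σ τ _ _ _ _ rfl rfl rfl rfl 1
  simp only [Nat.cast_one, one_mul, pow_one] at h
  rw [h]
  apply inducedMap_explicitFolding
  · rw [← Complex.exp_add]; simp
  · rw [← Complex.exp_add]; simp

theorem Phi_eq_cos (σ τ : ℝ) :
    Phi σ τ = ![((2 * Real.cos (2 * Real.pi * σ) + 2 * Real.cos (2 * Real.pi * τ) : ℝ) : ℂ),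
      (((2 * Real.cos (2 * Real.pi * σ)) * (2 * Real.cos (2 * Real.pi * τ)) : ℝ) : ℂ)] := by
  have h := Phi_eq σ τ _ _ _ _ rfl rfl rfl rfl 1
  simp only [Nat.cast_one, one_mul, pow_one] at h
  rw [h]
  push_cast
  simp only [Complex.two_cos]
  have e : ∀ x : ℝ, 2 * (Real.pi : ℂ) * x * Complex.I = 2 * Real.pi * Complex.I * x :=
    fun x => by ring
  have e' : ∀ x : ℝ, -(2 * (Real.pi : ℂ) * x) * Complex.I = -2 * Real.pi * Complex.I * x :=
    fun x => by ring
  simp only [e, e']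
  congr 1
  · ring
  · congr 1
    ring

theorem exists_Phi_eq (x y : ℝ) (hx : x ∈ Set.Icc (0 : ℝ) 1) (hy : y ∈ Set.Icc (-1 : ℝ) 0) :
    ∃ σ τ : ℝ, Phi σ τ = ![(x : ℂ), (y : ℂ)] := by
  obtain ⟨hx0, hx1⟩ := hx
  obtain ⟨hy0, hy1⟩ := hy
  have hd : 0 ≤ x ^ 2 - 4 * y := by nlinarith
  set r := Real.sqrt (x ^ 2 - 4 * y) with hr
  have hr2 : r ^ 2 = x ^ 2 - 4 * y := Real.sq_sqrt hd
  have hr0 : 0 ≤ r := Real.sqrt_nonneg _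
  have hr3 : r ≤ 3 := by nlinarith
  have hpi : (2 * Real.pi) ≠ 0 := by positivity
  have aux : ∀ s : ℝ, -4 ≤ s → s ≤ 4 →
      2 * Real.cos (2 * Real.pi * (Real.arccos (s / 4) / (2 * Real.pi))) = s / 2 := by
    intro s h1 h2
    rw [mul_div_cancel₀ _ hpi, Real.cos_arccos (by linarith) (by linarith)]
    ring
  refine ⟨Real.arccos ((x + r) / 4) / (2 * Real.pi),
    Real.arccos ((x - r) / 4) / (2 * Real.pi), ?_⟩
  rw [Phi_eq_cos, aux _ (by linarith) (by linarith), aux _ (by linarith) (by linarith)]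
  congr! 3
  · ring
  · linear_combination (-1 / 4) * hr2

/-- The functional equation determines the polynomials. -/
theorem IsFolding.unique {k : ℕ} {P Q : Fin 2 → MvPolynomial (Fin 2) ℤ}
    (hP : IsFolding k P) (hQ : IsFolding k Q) : P = Q := by
  funext i
  apply MvPolynomial.map_injective (Int.castRingHom ℂ) Int.cast_injective
  let s : Fin 2 → Set ℂ :=
    ![(fun x : ℝ => (x : ℂ)) '' Set.Icc 0 1, (fun x : ℝ => (x : ℂ)) '' Set.Icc (-1) 0]
  have hs : ∀ j, (s j).Infinite := by
    intro j
    fin_cases j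
    · exact (Set.Icc_infinite (by norm_num)).image Complex.ofReal_injective.injOn
    · exact (Set.Icc_infinite (by norm_num)).image Complex.ofReal_injective.injOn
  refine MvPolynomial.funext_set s hs ?_
  intro v hv
  obtain ⟨x, hx, hx'⟩ := hv 0 (Set.mem_univ _)
  obtain ⟨y, hy, hy'⟩ := hv 1 (Set.mem_univ _)
  obtain ⟨σ, τ, h⟩ := exists_Phi_eq x y hx hy
  have hv' : v = Phi σ τ := by
    rw [h]
    funext j
    fin_cases j
    · exact hx'.symm
    · exact hy'.symm
  have := congrFun ((hP σ τ).trans (hQ σ τ).symm) i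
  simpa [inducedMap, hv', aeval_def, eval_map] using this

theorem existsUnique_isFolding (k : ℕ) :
    ∃! P : Fin 2 → MvPolynomial (Fin 2) ℤ, IsFolding k P :=
  ⟨explicitFolding k, isFolding_explicitFolding k,
    fun _ hP => hP.unique (isFolding_explicitFolding k)⟩

/-- The `k`-th bivariate folding polynomial map of `B₂`: the unique pair of integer polynomials
with `P(Φ(σ,τ)) = Φ(kσ,kτ)` for all real `σ, τ`. -/
noncomputable def foldingPoly (k : ℕ) : Fin 2 → MvPolynomial (Fin 2) ℤ :=
  (existsUnique_isFolding k).choose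

theorem isFolding_foldingPoly (k : ℕ) : IsFolding k (foldingPoly k) :=
  (existsUnique_isFolding k).choose_spec.1

end FoldingB2

/-! Let `K` be an algebraic closure of `F` and `D` the Dickson polynomial with `D (x + x⁻¹) = x ^ k
+ x ^ (-k)`. In the coordinates `(u + v, u * v)` the folding map is `{u, v} ↦ {D u, D v}` on
unordered pairs. A pair gives a point of `F²` exactly when Frobenius preserves it: either `u`, `v`
both lie in `F`, or `v = u ^ q` with `u` fixed by the `q²`-power map. With `X = D(F_q)` and `Y =
D(F_{q²})`, the value set therefore consists of all pairs from `X` and all pairs `{s, s ^ q}` with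
`s ∈ Y`. These two families share only the diagonal pairs of `X`, so orbit counting gives `2 S + 2
|X| = |X| (|X| + 1) + |Y| + |Y ∩ F_q|` for the size `S`
(`FoldingB2.ncard_range_inducedMap_foldingPoly`).

All three sets are traces `x + x⁻¹` of roots of unity. The field `F_q` comes from orders `q - 1` and
`q + 1`, and `D` raises the roots to the power `k`, so `X` comes from orders `a`, `b` and `Y` from
`c`, `d` (`dickson_image_rootTraces`). The set `Y ∩ F_q` comes from `gcd(c, q - 1)` and `gcd(c, q +
1)`, which are `a`, `b`, or `2a`, `2b` when `k` and `c` are even (`gcd_div_gcd`); in the latter case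
`Y ∩ F_q` exceeds `X`. Traces of orders `m`, `n` number `(m + n) / 2`, plus `1/2` if the parities
differ (`two_mul_ncard_rootTraces`). This doubling and these halves make up `η`. -/

open Polynomial

/-! ### Valuations of the orders -/

/-- With `c = m * m' / gcd (m * m') k` and `gcd m m' ∣ 2`, the number of `m`-th roots of unity
among the `c`-th ones. -/
theorem gcd_div_gcd {m m' k : ℕ} (hm : 0 < m) (hm' : 0 < m') (hk : 0 < k)
    (hg : Nat.gcd m m' ∣ 2) (he : 2 ∣ m ↔ 2 ∣ m') :
    Nat.gcd (m * m' / Nat.gcd (m * m') k) m =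
      if 2 ∣ k ∧ 2 ∣ m * m' / Nat.gcd (m * m') k then 2 * (m / Nat.gcd m k)
      else m / Nat.gcd m k := by
  have hmm : m * m' ≠ 0 := by positivity
  have ha : m / Nat.gcd m k ≠ 0 :=
    (Nat.div_pos (Nat.gcd_le_left _ hm) (Nat.gcd_pos_of_pos_left _ hm)).ne'
  have hc : m * m' / Nat.gcd (m * m') k ≠ 0 :=
    (Nat.div_pos (Nat.gcd_le_left _ (by positivity)) (Nat.gcd_pos_of_pos_left _ (by positivity))).ne'
  have fa (p : ℕ) : (m / Nat.gcd m k).factorization p =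
      m.factorization p - min (m.factorization p) (k.factorization p) := by
    rw [Nat.factorization_div (Nat.gcd_dvd_left _ _), Nat.factorization_gcd hm.ne' hk.ne']
    rfl
  have fc (p : ℕ) : (m * m' / Nat.gcd (m * m') k).factorization p =
      (m.factorization p + m'.factorization p)
        - min (m.factorization p + m'.factorization p) (k.factorization p) := by
    rw [Nat.factorization_div (Nat.gcd_dvd_left _ _), Nat.factorization_gcd hmm hk.ne',
      Nat.factorization_mul hm.ne' hm'.ne']
    rfl
  have fg (p : ℕ) : (Nat.gcd (m * m' / Nat.gcd (m * m') k) m).factorization p =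
      min ((m * m' / Nat.gcd (m * m') k).factorization p) (m.factorization p) := by
    rw [Nat.factorization_gcd hc hm.ne']
    rfl
  have fh (p : ℕ) : min (m.factorization p) (m'.factorization p) ≤
      (Nat.factorization 2) p := by
    have := (Nat.factorization_le_iff_dvd (Nat.gcd_pos_of_pos_left _ hm).ne' two_ne_zero).2 hg p
    rwa [Nat.factorization_gcd hm.ne' hm'.ne'] at this
  have f2 (n : ℕ) (hn : n ≠ 0) : 2 ∣ n ↔ 1 ≤ n.factorization 2 := by
    rw [← Nat.prime_two.pow_dvd_iff_le_factorization hn, pow_one]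
  have h22 : Nat.factorization 2 2 = 1 := Nat.prime_two.factorization_self
  rw [f2 _ hm.ne', f2 _ hm'.ne'] at he
  simp only [f2 _ hk.ne', f2 _ hc]
  apply Nat.eq_of_factorization_eq (Nat.gcd_pos_of_pos_right _ hm).ne'
  · split_ifs <;> positivity
  intro p
  have hp := fh p
  have hp2 := fh 2
  rw [fg, fc]
  -- An odd `p` divides at most one of `m`, `m'`. At `2` the valuations are both zero, or both
  -- positive with minimum `1`; then `m * m'` can retain exactly one more factor `2` than `m` after
  -- division by the gcd with `k`.
  by_cases h : p = 2
  · subst h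
    split_ifs with h
    · rw [Nat.factorization_mul two_ne_zero ha, Finsupp.add_apply, fa]
      rw [fc] at h
      omega
    · rw [fa]
      rw [fc] at h
      omega
  · have h2p : Nat.factorization 2 p = 0 := by
      rw [Nat.prime_two.factorization]
      exact Finsupp.single_eq_of_ne h
    split_ifs
    · rw [Nat.factorization_mul two_ne_zero ha, Finsupp.add_apply, fa]
      omega
    · rw [fa]
      omega
-- Traces of roots of unity and Dickson polynomials
/-- The sums `x + x⁻¹` with `x` an `m`-th or an `n`-th root of unity. -/
def rootTraces (K : Type*) [Field K] (m n : ℕ) : Set K :=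
  (fun x => x + x⁻¹) '' {x | x ^ m = 1 ∨ x ^ n = 1}

theorem add_inv_eq_add_inv_iff {K : Type*} [Field K] {x y : K} (hx : x ≠ 0) (hy : y ≠ 0) :
    x + x⁻¹ = y + y⁻¹ ↔ y = x ∨ y = x⁻¹ := by
  constructor
  · intro h
    have : (y - x) * (y - x⁻¹) = 0 := by
      have h1 := mul_inv_cancel₀ hx
      have h2 := mul_inv_cancel₀ hy
      linear_combination (-y) * h + h1 - h2
    simpa [sub_eq_zero] using this
  · rintro (rfl | rfl)
    · rfl
    · rw [inv_inv, add_comm]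

theorem exists_add_inv {K : Type*} [Field K] [IsAlgClosed K] (s : K) :
    ∃ x : K, x ≠ 0 ∧ x + x⁻¹ = s := by
  obtain ⟨x, hx⟩ := IsAlgClosed.exists_root (X ^ 2 - C s * X + 1 : K[X]) (by
    have : (X ^ 2 - C s * X + 1 : K[X]).degree = 2 := by compute_degree!
    rw [this]; norm_num)
  simp [IsRoot] at hx
  have h0 : x ≠ 0 := by rintro rfl; simp at hx
  refine ⟨x, h0, ?_⟩
  field_simp
  linear_combination hx

/-- By additivity the `Q`-th power of the trace of `x` is the trace of `x ^ Q`, and two traces agree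
only for equal or inverse elements. Additivity is a hypothesis so that both `q` and `q ^ 2` can
serve as `Q`. -/
theorem add_inv_pow_eq_iff {K : Type*} [Field K] {Q : ℕ} (hQ : 1 ≤ Q)
    (hadd : ∀ x y : K, (x + y) ^ Q = x ^ Q + y ^ Q) {x : K} (hx : x ≠ 0) :
    (x + x⁻¹) ^ Q = x + x⁻¹ ↔ x ^ (Q - 1) = 1 ∨ x ^ (Q + 1) = 1 := by
  obtain ⟨Q, rfl⟩ := Nat.exists_eq_add_of_le' hQ
  rw [hadd, inv_pow, eq_comm, add_inv_eq_add_inv_iff hx (pow_ne_zero _ hx), Nat.add_sub_cancel]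
  refine or_congr ?_ ?_
  · rw [pow_succ, mul_eq_right₀ hx]
  · rw [pow_succ _ (Q + 1), ← mul_eq_one_iff_eq_inv₀ hx]

theorem setOf_pow_eq_self_eq_rootTraces {K : Type*} [Field K] [IsAlgClosed K] {Q : ℕ} (hQ : 2 ≤ Q)
    (hadd : ∀ x y : K, (x + y) ^ Q = x ^ Q + y ^ Q) :
    {s : K | s ^ Q = s} = rootTraces K (Q - 1) (Q + 1) := by
  ext s
  constructor
  · intro hs
    obtain ⟨x, hx, rfl⟩ := exists_add_inv s
    exact ⟨x, (add_inv_pow_eq_iff (by omega) hadd hx).1 hs, rfl⟩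
  · rintro ⟨x, hx, rfl⟩
    have h0 : x ≠ 0 := by
      rintro rfl
      rcases hx with hx | hx
      · rw [zero_pow (by omega)] at hx; exact zero_ne_one hx
      · rw [zero_pow (by omega)] at hx; exact zero_ne_one hx
    exact (add_inv_pow_eq_iff (by omega) hadd h0).2 hx

/-- Take `z` with `z ^ gcd m k = y`, so that `z ^ m = 1`. Writing the gcd as a Bézout combination of
`m` and `k`, the power of `z` by the coefficient of `k` is the desired root. -/
theorem exists_pow_eq_of_pow_div_gcd_eq_one {K : Type*} [Field K] [IsAlgClosed K] {m k : ℕ}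
    (hm : 0 < m) {y : K} (hy : y ^ (m / Nat.gcd m k) = 1) : ∃ x : K, x ^ m = 1 ∧ x ^ k = y := by
  have hg : 0 < Nat.gcd m k := Nat.gcd_pos_of_pos_left _ hm
  obtain ⟨z, rfl⟩ := IsAlgClosed.exists_pow_nat_eq y hg
  rw [← pow_mul, Nat.mul_div_cancel' (Nat.gcd_dvd_left m k)] at hy
  have hz : z ≠ 0 := by
    rintro rfl
    rw [zero_pow hm.ne'] at hy
    exact zero_ne_one hy
  refine ⟨z ^ Nat.gcdB m k, ?_, ?_⟩
  · rw [← zpow_natCast, zpow_comm, zpow_natCast, hy, one_zpow]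
  · rw [← zpow_natCast, ← zpow_natCast, Nat.gcd_eq_gcd_ab, zpow_add₀ hz, zpow_mul z m,
      zpow_natCast z m, hy, one_zpow, one_mul, ← zpow_mul, mul_comm]

theorem pow_pow_div_gcd_eq_one {K : Type*} [Field K] {m k : ℕ} {x : K} (hx : x ^ m = 1) :
    (x ^ k) ^ (m / Nat.gcd m k) = 1 := by
  rw [← pow_mul, ← Nat.mul_div_assoc _ (Nat.gcd_dvd_left m k), mul_comm,
    Nat.mul_div_assoc _ (Nat.gcd_dvd_right m k), pow_mul, hx, one_pow]

theorem ne_zero_of_pow_eq_one {K : Type*} [Field K] {m n : ℕ} (hm : 0 < m) (hn : 0 < n) {x : K}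
    (hx : x ^ m = 1 ∨ x ^ n = 1) : x ≠ 0 := by
  rintro rfl
  simp [hm.ne', hn.ne'] at hx

/-- On traces the Dickson polynomial is the `k`-th power map, which carries the `m`-th roots of
unity onto those of order dividing `m / gcd m k`. -/
theorem dickson_image_rootTraces {K : Type*} [Field K] [IsAlgClosed K] {m n : ℕ} (hm : 0 < m)
    (hn : 0 < n) (k : ℕ) :
    (fun s => (dickson 1 (1 : K) k).eval s) '' rootTraces K m n =
      rootTraces K (m / Nat.gcd m k) (n / Nat.gcd n k) := by
  have key {x : K} (hx : x ≠ 0) : (dickson 1 (1 : K) k).eval (x + x⁻¹) = x ^ k + (x ^ k)⁻¹ := by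
    rw [dickson_one_one_eval_add_inv _ _ (mul_inv_cancel₀ hx), inv_pow]
  ext s
  constructor
  · rintro ⟨_, ⟨x, hx, rfl⟩, rfl⟩
    refine ⟨x ^ k, ?_, (key (ne_zero_of_pow_eq_one hm hn hx)).symm⟩
    exact hx.imp pow_pow_div_gcd_eq_one pow_pow_div_gcd_eq_one
  · rintro ⟨y, hy, rfl⟩
    obtain ⟨x, hx, rfl⟩ : ∃ x : K, (x ^ m = 1 ∨ x ^ n = 1) ∧ x ^ k = y := by
      rcases hy with hy | hy
      · obtain ⟨x, h, h'⟩ := exists_pow_eq_of_pow_div_gcd_eq_one hm hy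
        exact ⟨x, Or.inl h, h'⟩
      · obtain ⟨x, h, h'⟩ := exists_pow_eq_of_pow_div_gcd_eq_one hn hy
        exact ⟨x, Or.inr h, h'⟩
    exact ⟨_, ⟨x, hx, rfl⟩, key (ne_zero_of_pow_eq_one hm hn hx)⟩

/-! ### Orbit counts -/

/-- Orbit counting for an involution `σ`: a function whose fibres are the orbits of `σ`. -/
theorem two_mul_card_image_of_involution {α β : Type*} [DecidableEq α] [DecidableEq β]
    (s : Finset α) (σ : α → α) (hσ : ∀ x ∈ s, σ x ∈ s) (g : α → β)
    (hg : ∀ x ∈ s, ∀ y ∈ s, g x = g y ↔ y = x ∨ y = σ x) :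
    2 * (s.image g).card = s.card + (s.filter fun x => σ x = x).card := by
  have h1 := Finset.card_eq_sum_card_image g s
  have hinj : Set.InjOn g (s.filter fun x => σ x = x) := by
    intro x hx y hy h
    simp only [Finset.coe_filter, Set.mem_ofPred_eq] at hx hy
    rcases (hg x hx.1 y hy.1).1 h with h | h
    · exact h.symm
    · rw [h, hx.2]
  have h2 : (s.filter fun x => σ x = x).card =
      ((s.image g).filter fun b => ∃ x ∈ s, σ x = x ∧ g x = b).card := by
    rw [← Finset.card_image_of_injOn hinj]
    congr 1
    ext b
    simp only [Finset.mem_image, Finset.mem_filter]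
    constructor
    · rintro ⟨x, ⟨hx, h⟩, rfl⟩
      exact ⟨⟨x, hx, rfl⟩, x, hx, h, rfl⟩
    · rintro ⟨_, x, hx, h, rfl⟩
      exact ⟨x, ⟨hx, h⟩, rfl⟩
  -- For each value the fibre size, plus one if the fibre contains a fixed point, equals `2`.
  rw [h1, h2, Finset.card_filter, ← Finset.sum_add_distrib, mul_comm, ← smul_eq_mul,
    ← Finset.sum_const]
  refine Finset.sum_congr rfl fun b hb => ?_
  obtain ⟨x, hx, rfl⟩ := Finset.mem_image.1 hb
  have hfib : s.filter (fun y => g y = g x) = {x, σ x} := by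
    ext y
    simp only [Finset.mem_filter, Finset.mem_insert, Finset.mem_singleton]
    constructor
    · rintro ⟨hy, h⟩
      exact (hg x hx y hy).1 h.symm
    · intro h
      have hy : y ∈ s := by
        rcases h with rfl | rfl
        · exact hx
        · exact hσ x hx
      exact ⟨hy, ((hg x hx y hy).2 h).symm⟩
  rw [hfib]
  by_cases h : σ x = x
  · rw [if_pos ⟨x, hx, h, rfl⟩, h]
    simp
  · rw [if_neg, Finset.card_pair (Ne.symm h)]
    rintro ⟨y, hy, hy', hyx⟩
    rcases (hg y hy x hx).1 hyx with h' | h'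
    · rw [h'] at h; exact h hy'
    · rw [hy'] at h'; rw [h'] at h; exact h hy'

theorem two_dvd_div_gcd_iff_of_odd {n k : ℕ} (hk : ¬ 2 ∣ k) : 2 ∣ n / Nat.gcd n k ↔ 2 ∣ n := by
  have hg : ¬ 2 ∣ Nat.gcd n k := fun h => hk (h.trans (Nat.gcd_dvd_right n k))
  conv_rhs => rw [← Nat.div_mul_cancel (Nat.gcd_dvd_left n k), Nat.prime_two.dvd_mul]
  simp [hg]

/-- If the quotient were even, `n` and hence its gcd with `k` would be even too, and the product of
the two factors would give `4 ∣ n`. -/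
theorem not_two_dvd_div_gcd_of_even {n k : ℕ} (hk : 2 ∣ k) (hn : ¬ 4 ∣ n) :
    ¬ 2 ∣ n / Nat.gcd n k := by
  intro h
  have hn2 : 2 ∣ n := h.trans (Nat.div_dvd_of_dvd (Nat.gcd_dvd_left n k))
  have := Nat.mul_dvd_mul h (Nat.dvd_gcd hn2 hk)
  rw [Nat.div_mul_cancel (Nat.gcd_dvd_left n k)] at this
  exact hn this

theorem nthRootsFinset_one_inter {K : Type*} [Field K] [DecidableEq K] {m n : ℕ} (hm : 0 < m)
    (hn : 0 < n) :
    nthRootsFinset m (1 : K) ∩ nthRootsFinset n (1 : K) = nthRootsFinset (Nat.gcd m n) (1 : K) := by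
  ext x
  rw [Finset.mem_inter, mem_nthRootsFinset hm, mem_nthRootsFinset hn,
    mem_nthRootsFinset (Nat.gcd_pos_of_pos_left _ hm), pow_gcd_eq_one]

theorem card_nthRootsFinset_one {K : Type*} [Field K] [IsAlgClosed K] {m : ℕ}
    (hm : (m : K) ≠ 0) : (nthRootsFinset m (1 : K)).card = m := by
  have : NeZero (m : K) := ⟨hm⟩
  obtain ⟨ζ, hζ⟩ := HasEnoughRootsOfUnity.exists_primitiveRoot K m
  exact hζ.card_nthRootsFinset

theorem rootTraces_eq_image {K : Type*} [Field K] [DecidableEq K] {m n : ℕ} (hm : 0 < m)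
    (hn : 0 < n) :
    rootTraces K m n =
      ((nthRootsFinset m (1 : K) ∪ nthRootsFinset n (1 : K)).image fun x => x + x⁻¹ : Finset K) := by
  ext s
  simp [rootTraces, mem_nthRootsFinset hm, mem_nthRootsFinset hn]

/-- Traces are the orbits of inversion on the union of the two root groups. That union has `m + n -
gcd m n` elements, and the fixed points are the square roots of `1` in it. The gcd and the number of
fixed points cancel unless the parities differ, when they are `1` and `2`. -/
theorem two_mul_ncard_rootTraces {K : Type*} [Field K] [IsAlgClosed K] {m n : ℕ}
    (hm : (m : K) ≠ 0) (hn : (n : K) ≠ 0) (hg : Nat.gcd m n ∣ 2) :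
    2 * (rootTraces K m n).ncard = m + n + if 2 ∣ m ↔ 2 ∣ n then 0 else 1 := by
  classical
  have hm0 : 0 < m := Nat.pos_of_ne_zero (by rintro rfl; simp at hm)
  have hn0 : 0 < n := Nat.pos_of_ne_zero (by rintro rfl; simp at hn)
  have hg0 : ((Nat.gcd m n : ℕ) : K) ≠ 0 := by
    obtain ⟨c, hc⟩ := Nat.gcd_dvd_left m n
    intro h
    rw [hc, Nat.cast_mul, h, zero_mul] at hm
    exact hm rfl
  have hinv : ∀ x ∈ nthRootsFinset m (1 : K) ∪ nthRootsFinset n (1 : K),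
      x⁻¹ ∈ nthRootsFinset m (1 : K) ∪ nthRootsFinset n (1 : K) := by
    intro x
    simp [mem_nthRootsFinset hm0, mem_nthRootsFinset hn0]
  have hne : ∀ x ∈ nthRootsFinset m (1 : K) ∪ nthRootsFinset n (1 : K), x ≠ 0 := by
    intro x hx
    rw [Finset.mem_union, mem_nthRootsFinset hm0, mem_nthRootsFinset hn0] at hx
    exact ne_zero_of_pow_eq_one hm0 hn0 hx
  rw [rootTraces_eq_image hm0 hn0, Set.ncard_coe_finset,
    two_mul_card_image_of_involution _ (fun x => x⁻¹) hinv _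
      (fun x hx y hy => add_inv_eq_add_inv_iff (hne x hx) (hne y hy))]
  have hfix : (nthRootsFinset m (1 : K) ∪ nthRootsFinset n (1 : K)).filter (fun x => x⁻¹ = x) =
      nthRootsFinset (Nat.gcd m 2) (1 : K) ∪ nthRootsFinset (Nat.gcd n 2) (1 : K) := by
    rw [← nthRootsFinset_one_inter hm0 two_pos, ← nthRootsFinset_one_inter hn0 two_pos,
      ← Finset.union_inter_distrib_right]
    ext x
    rw [Finset.mem_filter, Finset.mem_inter, mem_nthRootsFinset two_pos]
    refine and_congr_right fun hx => ?_
    rw [eq_comm, ← mul_eq_one_iff_eq_inv₀ (hne x hx), pow_two]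
  have hu := Finset.card_union_add_card_inter (nthRootsFinset m (1 : K)) (nthRootsFinset n (1 : K))
  rw [nthRootsFinset_one_inter hm0 hn0, card_nthRootsFinset_one hm, card_nthRootsFinset_one hn,
    card_nthRootsFinset_one hg0] at hu
  -- An even number that is nonzero in `K` forces characteristic different from `2`, so `1` has two
  -- square roots.
  have h2 (j : ℕ) (hj : (j : K) ≠ 0) (hj2 : 2 ∣ j) : (nthRootsFinset 2 (1 : K)).card = 2 := by
    refine card_nthRootsFinset_one ?_
    obtain ⟨c, rfl⟩ := hj2
    intro h
    rw [Nat.cast_mul, h, zero_mul] at hj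
    exact hj rfl
  have e1 (j : ℕ) (hj : 2 ∣ j) : Nat.gcd j 2 = 2 := Nat.gcd_eq_right hj
  have e2 (j : ℕ) (hj : ¬ 2 ∣ j) : Nat.gcd j 2 = 1 := by
    rw [← Nat.coprime_iff_gcd_eq_one, Nat.coprime_comm]
    exact (Nat.Prime.coprime_iff_not_dvd Nat.prime_two).2 hj
  have hsub : nthRootsFinset 1 (1 : K) ⊆ nthRootsFinset 2 (1 : K) := by
    intro x
    rw [mem_nthRootsFinset one_pos, mem_nthRootsFinset two_pos, pow_one]
    rintro rfl
    exact one_pow 2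
  have hone : (nthRootsFinset 1 (1 : K)).card = 1 := card_nthRootsFinset_one (by simp)
  have hgc : Nat.gcd m n = 1 ∨ Nat.gcd m n = 2 := (Nat.dvd_prime Nat.prime_two).1 hg
  have hgm := Nat.gcd_dvd_left m n
  have hgn := Nat.gcd_dvd_right m n
  rw [hfix]
  by_cases hm2 : 2 ∣ m <;> by_cases hn2 : 2 ∣ n
  · rw [e1 m hm2, e1 n hn2, Finset.union_self, h2 m hm hm2]
    have : 2 ∣ Nat.gcd m n := Nat.dvd_gcd hm2 hn2
    simp only [hm2, hn2, if_true]
    omega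
  · rw [e1 m hm2, e2 n hn2, Finset.union_eq_left.2 hsub, h2 m hm hm2]
    simp only [hm2, hn2, iff_false, not_true, if_false]
    rcases hgc with h | h <;> rw [h] at hgn hu <;> omega
  · rw [e2 m hm2, e1 n hn2, Finset.union_eq_right.2 hsub, h2 n hn hn2]
    simp only [hm2, hn2, iff_true, if_false]
    rcases hgc with h | h <;> rw [h] at hgm hu <;> omega
  · rw [e2 m hm2, e2 n hn2, Finset.union_self, hone]
    simp only [hm2, hn2, if_true]
    rcases hgc with h | h <;> rw [h] at hgm hu <;> omega

/-- The gcd conditions ensure that a `d`-th root of unity whose trace is fixed is already a `c`-th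
root of unity, so `d` contributes nothing new. -/
theorem rootTraces_inter_setOf_pow_eq_self {K : Type*} [Field K] {Q c d : ℕ} (hQ : 1 ≤ Q)
    (hadd : ∀ x y : K, (x + y) ^ Q = x ^ Q + y ^ Q) (hc : 0 < c) (hd : 0 < d)
    (h₁ : Nat.gcd d (Q - 1) ∣ c) (h₂ : Nat.gcd d (Q + 1) ∣ c) :
    rootTraces K c d ∩ {s | s ^ Q = s} =
      rootTraces K (Nat.gcd c (Q - 1)) (Nat.gcd c (Q + 1)) := by
  have key {j : ℕ} (hj : Nat.gcd d j ∣ c) {x : K} (hx : x ^ c = 1 ∨ x ^ d = 1)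
      (hxj : x ^ j = 1) : x ^ Nat.gcd c j = 1 := by
    rw [pow_gcd_eq_one]
    refine ⟨hx.elim id fun hx => ?_, hxj⟩
    obtain ⟨e, he⟩ := hj
    rw [he, pow_mul, pow_gcd_eq_one.2 ⟨hx, hxj⟩, one_pow]
  ext s
  constructor
  · rintro ⟨⟨x, hx, rfl⟩, hs⟩
    refine ⟨x, ?_, rfl⟩
    exact ((add_inv_pow_eq_iff hQ hadd (ne_zero_of_pow_eq_one hc hd hx)).1 hs).imp
      (key h₁ hx) (key h₂ hx)
  · rintro ⟨x, hx, rfl⟩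
    have hxc : x ^ c = 1 := by
      rcases hx with hx | hx
      · exact (pow_gcd_eq_one.1 hx).1
      · exact (pow_gcd_eq_one.1 hx).1
    refine ⟨⟨x, Or.inl hxc, rfl⟩, ?_⟩
    refine (add_inv_pow_eq_iff hQ hadd (ne_zero_of_pow_eq_one hc hc (Or.inl hxc))).2 ?_
    exact hx.imp (fun h => (pow_gcd_eq_one.1 h).2) (fun h => (pow_gcd_eq_one.1 h).2)

/-- Inclusion–exclusion: the pairs `{s, φ s}` are the orbits of the involution `φ` on `Y`, and since
`φ` fixes `X` pointwise, those lying inside `X` are diagonal. -/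
theorem card_sym2_union_orbits {α : Type*} [DecidableEq α] (X Y : Finset α) (φ : α → α)
    (hXY : X ⊆ Y) (hX : ∀ x ∈ X, φ x = x) (hY : ∀ y ∈ Y, φ y ∈ Y)
    (hφ : ∀ y ∈ Y, φ (φ y) = y) :
    2 * (X.sym2 ∪ Y.image fun s => s(s, φ s)).card + 2 * X.card =
      X.card * (X.card + 1) + Y.card + (Y.filter fun s => φ s = s).card := by
  have h1 := two_mul_card_image_of_involution Y φ hY (fun s => s(s, φ s)) (by
    intro x hx y hy
    constructor
    · intro h
      rcases Sym2.eq_iff.1 h with ⟨h, _⟩ | ⟨_, h⟩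
      · exact Or.inl h.symm
      · exact Or.inr h.symm
    · rintro (rfl | rfl)
      · rfl
      · simp only [hφ x hx]
        exact Sym2.eq_swap)
  have h2 : X.sym2 ∩ Y.image (fun s => s(s, φ s)) = X.image fun s => s(s, s) := by
    ext z
    simp only [Finset.mem_inter, Finset.mem_image]
    constructor
    · rintro ⟨hz, y, _, rfl⟩
      rw [Finset.mk_mem_sym2_iff] at hz
      have h := hX _ hz.2
      rw [hφ y ‹_›] at h
      exact ⟨y, hz.1, by rw [← h]⟩
    · rintro ⟨x, hx, rfl⟩
      exact ⟨Finset.mk_mem_sym2_iff.2 ⟨hx, hx⟩, x, hXY hx, by rw [hX x hx]⟩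
  have h3 : (X.image fun s => s(s, s)).card = X.card :=
    Finset.card_image_of_injective _ fun x y h => by simpa using h
  have h4 := Finset.card_union_add_card_inter X.sym2 (Y.image fun s => s(s, φ s))
  rw [h2, h3, Finset.card_sym2] at h4
  have h5 : 2 * Nat.choose (X.card + 1) 2 = X.card * (X.card + 1) := by
    rw [Nat.choose_two_right, Nat.add_sub_cancel, mul_comm (X.card + 1),
      Nat.mul_div_cancel' (Nat.even_mul_succ_self _).two_dvd]
  omega

/-! ### The folding map on Frobenius-stable pairs -/

/-- With `u = w + w⁻¹` and `v = z + z⁻¹` the two coordinates are the orbit sums of `B₂`, and the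
folding map raises `w` and `z` to the power `k`. -/
theorem FoldingB2.inducedMap_foldingPoly_add_mul {K : Type*} [Field K] [IsAlgClosed K] (k : ℕ)
    (u v : K) :
    FoldingB2.inducedMap K (FoldingB2.foldingPoly k) ![u + v, u * v] =
      ![(dickson 1 (1 : K) k).eval u + (dickson 1 (1 : K) k).eval v,
        (dickson 1 (1 : K) k).eval u * (dickson 1 (1 : K) k).eval v] := by
  obtain ⟨w, hw, rfl⟩ := exists_add_inv u
  obtain ⟨z, hz, rfl⟩ := exists_add_inv v
  have hw' := mul_inv_cancel₀ hw
  have hz' := mul_inv_cancel₀ hz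
  rw [(FoldingB2.isFolding_foldingPoly k).unique (FoldingB2.isFolding_explicitFolding k),
    dickson_one_one_eval_add_inv _ _ hw', dickson_one_one_eval_add_inv _ _ hz']
  have h := FoldingB2.inducedMap_explicitFolding k w w⁻¹ z z⁻¹ hw' hz'
  have e₁ : w + w⁻¹ + (z + z⁻¹) = w + w⁻¹ + z + z⁻¹ := by ring
  have e₂ : (w + w⁻¹) * (z + z⁻¹) = w * z + w⁻¹ * z⁻¹ + w * z⁻¹ + z * w⁻¹ := by ring
  rw [e₁, e₂, h]
  congr 1
  · ring
  · congr 1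
    simp only [mul_pow]
    ring

theorem FoldingB2.inducedMap_algebraMap {F K : Type*} [Field F] [Field K] [Algebra F K]
    (P : Fin 2 → MvPolynomial (Fin 2) ℤ) (v : Fin 2 → F) :
    FoldingB2.inducedMap K P (fun i => algebraMap F K (v i)) =
      fun i => algebraMap F K (FoldingB2.inducedMap F P v i) := by
  funext i
  exact MvPolynomial.aeval_algebraMap_apply K v (P i)

/-- The polynomial `X ^ q - X` has at most `q` roots, and the image of `F` already supplies `q` of
them. -/
theorem mem_range_algebraMap_iff_pow_card {F K : Type*} [Field F] [Fintype F] [Field K]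
    [Algebra F K] (x : K) :
    x ∈ Set.range (algebraMap F K) ↔ x ^ Fintype.card F = x := by
  classical
  constructor
  · rintro ⟨y, rfl⟩
    rw [← map_pow, FiniteField.pow_card]
  · intro hx
    have hne : (X ^ Fintype.card F - X : K[X]) ≠ 0 :=
      FiniteField.X_pow_card_sub_X_ne_zero K Fintype.one_lt_card
    have hsub : Finset.univ.image (algebraMap F K) ⊆
        (X ^ Fintype.card F - X : K[X]).roots.toFinset := by
      intro z hz
      obtain ⟨y, _, rfl⟩ := Finset.mem_image.1 hz
      simp [hne, IsRoot, ← map_pow, FiniteField.pow_card]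
    have hcard : (X ^ Fintype.card F - X : K[X]).roots.toFinset.card ≤
        (Finset.univ.image (algebraMap F K)).card := by
      rw [Finset.card_image_of_injective _ (algebraMap F K).injective, Finset.card_univ]
      refine (Multiset.toFinset_card_le _).trans ((card_roots' _).trans ?_)
      rw [FiniteField.X_pow_card_sub_X_natDegree_eq K Fintype.one_lt_card]
    have hmem : x ∈ (X ^ Fintype.card F - X : K[X]).roots.toFinset := by
      simp [hne, IsRoot, hx]
    rw [← Finset.eq_of_subset_of_card_le hsub hcard] at hmem
    simpa using hmem

theorem add_pow_card_of_algebra {F K : Type*} [Field F] [Fintype F] [Field K] [Algebra F K]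
    (x y : K) : (x + y) ^ Fintype.card F = x ^ Fintype.card F + y ^ Fintype.card F :=
  map_add (FiniteField.frobeniusAlgHom F K) x y

/-- The coefficients come from the integers, so Frobenius fixes them. -/
theorem dickson_eval_pow_card {F K : Type*} [Field F] [Fintype F] [Field K] [Algebra F K] (k : ℕ)
    (x : K) : (dickson 1 (1 : K) k).eval x ^ Fintype.card F =
      (dickson 1 (1 : K) k).eval (x ^ Fintype.card F) := by
  change ((FiniteField.frobeniusAlgHom F K : K →ₐ[F] K) : K →+* K) _ =
    (dickson 1 (1 : K) k).eval (((FiniteField.frobeniusAlgHom F K : K →ₐ[F] K) : K →+* K) x)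
  rw [← eval_map_apply, map_dickson, map_one]

/-- The unordered pair `{u, v}` as the pair `(u + v, u * v)` of its symmetric functions. -/
def Sym2.addMul {K : Type*} [Field K] : Sym2 K → Fin 2 → K :=
  Sym2.lift ⟨fun u v => ![u + v, u * v], fun u v => by simp only [add_comm, mul_comm]⟩

theorem Sym2.addMul_injective {K : Type*} [Field K] :
    Function.Injective (Sym2.addMul : Sym2 K → Fin 2 → K) := by
  intro z z'
  induction z with | _ u v
  induction z' with | _ u' v'
  intro h
  have h0 : u + v = u' + v' := congrFun h 0
  have h1 : u * v = u' * v' := congrFun h 1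
  have h2 : (u - u') * (u - v') = 0 := by linear_combination u * h0 - h1
  rcases mul_eq_zero.1 h2 with h | h
  · have h := sub_eq_zero.1 h
    subst h
    rw [add_left_cancel h0]
  · have h := sub_eq_zero.1 h
    subst h
    rw [show v = u' by linear_combination h0]
    exact Sym2.eq_swap

/-- The value set of the folding map, as a set of unordered pairs in an algebraic closure. -/
theorem FoldingB2.image_range_inducedMap_foldingPoly {F K : Type*} [Field F] [Fintype F] [Field K]
    [Algebra F K] [IsAlgClosed K] (k : ℕ) :
    (fun (v : Fin 2 → F) i => algebraMap F K (v i)) ''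
        Set.range (FoldingB2.inducedMap F (FoldingB2.foldingPoly k)) =
      Sym2.addMul '' ({z | ∃ s ∈ (fun x => (dickson 1 (1 : K) k).eval x) ''
            {x | x ^ Fintype.card F = x}, ∃ t ∈ (fun x => (dickson 1 (1 : K) k).eval x) ''
            {x | x ^ Fintype.card F = x}, z = s(s, t)} ∪
          (fun s => s(s, s ^ Fintype.card F)) '' ((fun x => (dickson 1 (1 : K) k).eval x) ''
            {x | x ^ Fintype.card F ^ 2 = x})) := by
  have hadd := add_pow_card_of_algebra (F := F) (K := K)
  have hD := dickson_eval_pow_card (F := F) (K := K) k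
  have hB (v : Fin 2 → F) (x y : K) (h0 : algebraMap F K (v 0) = x + y)
      (h1 : algebraMap F K (v 1) = x * y) :
      (fun i => algebraMap F K (FoldingB2.inducedMap F (FoldingB2.foldingPoly k) v i)) =
        Sym2.addMul s((dickson 1 (1 : K) k).eval x, (dickson 1 (1 : K) k).eval y) := by
    rw [← FoldingB2.inducedMap_algebraMap]
    have : (fun i => algebraMap F K (v i)) = ![x + y, x * y] := by
      funext i
      fin_cases i
      · exact h0
      · exact h1
    rw [this, FoldingB2.inducedMap_foldingPoly_add_mul]
    rfl
  have hF (s p : K) (hs : s ^ Fintype.card F = s) (hp : p ^ Fintype.card F = p) :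
      ∃ v : Fin 2 → F, algebraMap F K (v 0) = s ∧ algebraMap F K (v 1) = p := by
    obtain ⟨s, rfl⟩ := (mem_range_algebraMap_iff_pow_card s).2 hs
    obtain ⟨p, rfl⟩ := (mem_range_algebraMap_iff_pow_card p).2 hp
    exact ⟨![s, p], rfl, rfl⟩
  apply Set.Subset.antisymm
  · rintro _ ⟨_, ⟨v, rfl⟩, rfl⟩
    have h0 := (mem_range_algebraMap_iff_pow_card (algebraMap F K (v 0))).1 ⟨v 0, rfl⟩
    have h1 := (mem_range_algebraMap_iff_pow_card (algebraMap F K (v 1))).1 ⟨v 1, rfl⟩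
    obtain ⟨x, y, hs, hp⟩ : ∃ x y : K, algebraMap F K (v 0) = x + y ∧
        algebraMap F K (v 1) = x * y := by
      obtain ⟨x, hx⟩ := IsAlgClosed.exists_root
        (X ^ 2 - C (algebraMap F K (v 0)) * X + C (algebraMap F K (v 1)) : K[X]) (by
        have : (X ^ 2 - C (algebraMap F K (v 0)) * X +
            C (algebraMap F K (v 1)) : K[X]).degree = 2 := by
          compute_degree!
        rw [this]; norm_num)
      simp [IsRoot] at hx
      exact ⟨x, algebraMap F K (v 0) - x, by ring, by linear_combination hx⟩
    refine ⟨_, ?_, (hB v x y hs hp).symm⟩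
    rw [hs, hadd] at h0
    rw [hp, mul_pow] at h1
    -- The quadratic with roots `x`, `y` has coefficients in `F`, so Frobenius sends `x` to one of
    -- its roots. The root `x` itself gives a pair in `F`; the root `y` gives a conjugate pair.
    have h2 : (x ^ Fintype.card F - x) * (x ^ Fintype.card F - y) = 0 := by
      linear_combination x ^ Fintype.card F * h0 - h1
    rcases mul_eq_zero.1 h2 with h | h
    · have hx := sub_eq_zero.1 h
      have hy : y ^ Fintype.card F = y := by linear_combination h0 - hx
      exact Or.inl ⟨_, ⟨x, hx, rfl⟩, _, ⟨y, hy, rfl⟩, rfl⟩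
    · have hx := sub_eq_zero.1 h
      have hy : y ^ Fintype.card F = x := by linear_combination h0 - hx
      refine Or.inr ⟨_, ⟨x, ?_, rfl⟩, ?_⟩
      · rw [Set.mem_ofPred_eq, pow_two, pow_mul, hx, hy]
      · simp only [hD, hx]
  · rintro _ ⟨_, ⟨_, ⟨x, hx, rfl⟩, _, ⟨y, hy, rfl⟩, rfl⟩ | ⟨_, ⟨x, hx, rfl⟩, rfl⟩, rfl⟩
    · rw [Set.mem_ofPred_eq] at hx hy
      obtain ⟨v, h0, h1⟩ := hF (x + y) (x * y) (by rw [hadd, hx, hy]) (by rw [mul_pow, hx, hy])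
      exact ⟨_, ⟨v, rfl⟩, hB v x y h0 h1⟩
    · rw [Set.mem_ofPred_eq, pow_two, pow_mul] at hx
      obtain ⟨v, h0, h1⟩ := hF (x + x ^ Fintype.card F) (x * x ^ Fintype.card F)
        (by rw [hadd, hx, add_comm]) (by rw [mul_pow, hx, mul_comm])
      refine ⟨_, ⟨v, rfl⟩, ?_⟩
      simp only [hD]
      exact hB v x _ h0 h1

theorem finite_rootTraces {K : Type*} [Field K] {m n : ℕ} (hm : 0 < m)
    (hn : 0 < n) : (rootTraces K m n).Finite := by
  classical
  rw [rootTraces_eq_image hm hn]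
  exact Finset.finite_toSet _

/-- The size of the value set, in terms of the value sets of Dickson polynomials. -/
theorem FoldingB2.ncard_range_inducedMap_foldingPoly {F K : Type*} [Field F] [Fintype F] [Field K]
    [Algebra F K] [IsAlgClosed K] (k : ℕ) {X Y : Set K}
    (hXdef : X = (fun x => (dickson 1 (1 : K) k).eval x) '' {x | x ^ Fintype.card F = x})
    (hYdef : Y = (fun x => (dickson 1 (1 : K) k).eval x) '' {x | x ^ Fintype.card F ^ 2 = x})
    (hXfin : X.Finite) (hYfin : Y.Finite) :
    2 * (Set.range (FoldingB2.inducedMap F (FoldingB2.foldingPoly k))).ncard + 2 * X.ncard =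
      X.ncard * (X.ncard + 1) + Y.ncard + (Y ∩ {s | s ^ Fintype.card F = s}).ncard := by
  classical
  have hD := dickson_eval_pow_card (F := F) (K := K) k
  have himg := FoldingB2.image_range_inducedMap_foldingPoly (F := F) (K := K) k
  rw [← hXdef, ← hYdef] at himg
  lift X to Finset K using hXfin
  lift Y to Finset K using hYfin
  have hfin : ({z | ∃ s ∈ (X : Set K), ∃ t ∈ (X : Set K), z = s(s, t)} ∪
      (fun s => s(s, s ^ Fintype.card F)) '' (Y : Set K) : Set (Sym2 K)) =
      ((X.sym2 ∪ Y.image fun s => s(s, s ^ Fintype.card F) : Finset (Sym2 K)) : Set (Sym2 K)) := by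
    rw [Finset.coe_union, Finset.coe_image]
    congr 1
    ext z
    induction z with | _ u v
    simp only [Set.mem_ofPred_eq, Finset.mem_coe, Finset.mk_mem_sym2_iff]
    constructor
    · rintro ⟨s, hs, t, ht, h⟩
      rcases Sym2.eq_iff.1 h with ⟨rfl, rfl⟩ | ⟨rfl, rfl⟩
      · exact ⟨hs, ht⟩
      · exact ⟨ht, hs⟩
    · rintro ⟨hu, hv⟩
      exact ⟨u, hu, v, hv, rfl⟩
  have hmemX (s : K) : s ∈ X ↔ ∃ x : K, x ^ Fintype.card F = x ∧
      (dickson 1 (1 : K) k).eval x = s := by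
    rw [← Finset.mem_coe, hXdef]; rfl
  have hmemY (s : K) : s ∈ Y ↔ ∃ x : K, x ^ Fintype.card F ^ 2 = x ∧
      (dickson 1 (1 : K) k).eval x = s := by
    rw [← Finset.mem_coe, hYdef]; rfl
  have hinj : Function.Injective fun (v : Fin 2 → F) i => algebraMap F K (v i) := by
    intro v v' h
    funext i
    exact (algebraMap F K).injective (congrFun h i)
  -- Since `D` commutes with Frobenius, Frobenius is trivial on `X` and an involution on `Y`.
  have hcard := card_sym2_union_orbits X Y (fun s => s ^ Fintype.card F)
    (by
      intro s hs
      obtain ⟨x, hx, rfl⟩ := (hmemX s).1 hs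
      exact (hmemY _).2 ⟨x, by rw [pow_two, pow_mul, hx, hx], rfl⟩)
    (by
      intro s hs
      obtain ⟨x, hx, rfl⟩ := (hmemX s).1 hs
      rw [hD, hx])
    (by
      intro s hs
      obtain ⟨x, hx, rfl⟩ := (hmemY s).1 hs
      refine (hmemY _).2 ⟨x ^ Fintype.card F, ?_, (hD x).symm⟩
      rw [← pow_mul, mul_comm, pow_mul, hx])
    (by
      intro s hs
      obtain ⟨x, hx, rfl⟩ := (hmemY s).1 hs
      rw [hD, hD, ← pow_mul, ← pow_two, hx])
  have hfilter : ((Y : Set K) ∩ {s | s ^ Fintype.card F = s}) =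
      (Y.filter fun s => s ^ Fintype.card F = s : Finset K) := by
    ext s
    simp
  rw [← Set.ncard_image_of_injective _ hinj, himg,
    Set.ncard_image_of_injective _ Sym2.addMul_injective, hfin, Set.ncard_coe_finset, hfilter,
    Set.ncard_coe_finset, Set.ncard_coe_finset, Set.ncard_coe_finset, hcard]

/-! ### Parities of the orders and the final count -/

/-- The numerical facts about `a, b, c, d` behind the value set count. -/
theorem quotient_gcd_arith {q k : ℕ} (hq : 2 ≤ q) (hk : 0 < k) {a b c d : ℕ}
    (ha : a = (q - 1) / Nat.gcd (q - 1) k) (hb : b = (q + 1) / Nat.gcd (q + 1) k)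
    (hc : c = (q ^ 2 - 1) / Nat.gcd (q ^ 2 - 1) k)
    (hd : d = (q ^ 2 + 1) / Nat.gcd (q ^ 2 + 1) k) :
    (Nat.gcd c (q - 1) = if 2 ∣ k ∧ 2 ∣ c then 2 * a else a) ∧
      (Nat.gcd c (q + 1) = if 2 ∣ k ∧ 2 ∣ c then 2 * b else b) ∧
      (¬ 2 ∣ k → ((2 ∣ a ↔ 2 ∣ b) ∧ (2 ∣ c ↔ 2 ∣ d))) ∧ (2 ∣ k → ¬ 2 ∣ d) ∧
      (¬ 2 ∣ c → ¬ 2 ∣ a ∧ ¬ 2 ∣ b ∧ ¬ 2 ∣ d) ∧ (2 ∣ k → ¬ (2 ∣ a ∧ 2 ∣ b)) ∧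
      Nat.gcd (q - 1) (q + 1) ∣ 2 ∧ Nat.gcd (q ^ 2 - 1) (q ^ 2 + 1) ∣ 2 := by
  obtain ⟨m, rfl⟩ : ∃ m, q = m + 1 := ⟨q - 1, by omega⟩
  have hm : 0 < m := by omega
  have e₁ : (m + 1) ^ 2 - 1 = m * (m + 2) := by
    rw [Nat.sub_eq_of_eq_add]; ring
  have e₂ : (m + 1) ^ 2 + 1 = m * (m + 2) + 2 := by ring
  have e₃ : m + 1 + 1 = m + 2 := rfl
  rw [e₁] at hc ⊢
  rw [e₂] at hd ⊢
  rw [e₃] at hb ⊢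
  rw [Nat.add_sub_cancel] at ha ⊢
  have g₁ (n : ℕ) : Nat.gcd n (n + 2) ∣ 2 :=
    (Nat.dvd_add_right (Nat.gcd_dvd_left n (n + 2))).1 (Nat.gcd_dvd_right n (n + 2))
  have p₁ (n : ℕ) : 2 ∣ n ↔ 2 ∣ n + 2 := by omega
  have hca := gcd_div_gcd hm (by omega : 0 < m + 2) hk (g₁ m) (p₁ m)
  have hcb := gcd_div_gcd (by omega : 0 < m + 2) hm hk (by rw [Nat.gcd_comm]; exact g₁ m)
    (p₁ m).symm
  rw [mul_comm (m + 2) m] at hcb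
  rw [← ha, ← hc] at hca
  rw [← hb, ← hc] at hcb
  have hac : a ∣ c := by
    refine Dvd.dvd.trans ?_ (Nat.gcd_dvd_left c m)
    rw [hca]
    split_ifs
    · exact Dvd.intro_left _ rfl
    · exact dvd_rfl
  have hbc : b ∣ c := by
    refine Dvd.dvd.trans ?_ (Nat.gcd_dvd_left c (m + 2))
    rw [hcb]
    split_ifs
    · exact Dvd.intro_left _ rfl
    · exact dvd_rfl
  -- Here `m = q - 1`, and `q ^ 2 + 1` is `1` or `2` modulo `4`.
  have hd4 : ¬ 4 ∣ m * (m + 2) + 2 := by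
    rcases Nat.even_or_odd' m with ⟨t, rfl | rfl⟩
    · have : 2 * t * (2 * t + 2) + 2 = 4 * (t * (t + 1)) + 2 := by ring
      omega
    · have : (2 * t + 1) * (2 * t + 1 + 2) + 2 = 4 * (t * t + 2 * t + 1) + 1 := by ring
      omega
  have hkd : 2 ∣ k → ¬ 2 ∣ d := fun h => hd ▸ not_two_dvd_div_gcd_of_even h hd4
  have hodd : ¬ 2 ∣ k → ((2 ∣ a ↔ 2 ∣ b) ∧ (2 ∣ c ↔ 2 ∣ d)) := by
    intro h
    rw [ha, hb, hc, hd]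
    simp only [two_dvd_div_gcd_iff_of_odd h]
    exact ⟨p₁ m, p₁ _⟩
  refine ⟨hca, hcb, hodd, hkd, ?_, ?_, g₁ m, g₁ _⟩
  · intro h
    refine ⟨fun h' => h (h'.trans hac), fun h' => h (h'.trans hbc), fun h' => ?_⟩
    by_cases hk2 : 2 ∣ k
    · exact hkd hk2 h'
    · exact h ((hodd hk2).2.2 h')
  · rintro h ⟨h₁, h₂⟩
    -- At most one of `q - 1` and `q + 1` is divisible by `4`; the other has an odd quotient.
    by_cases h4 : 4 ∣ m
    · exact not_two_dvd_div_gcd_of_even h (by omega : ¬ 4 ∣ m + 2) (hb ▸ h₂)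
    · exact not_two_dvd_div_gcd_of_even h h4 (ha ▸ h₁)

theorem natCast_ne_zero_of_dvd {R : Type*} [Semiring R] {m n : ℕ} (h : m ∣ n)
    (hn : (n : R) ≠ 0) : (m : R) ≠ 0 := by
  obtain ⟨c, rfl⟩ := h
  intro h
  rw [Nat.cast_mul, h, zero_mul] at hn
  exact hn rfl

theorem gcd_dvd_gcd_of_dvd {m m' n n' : ℕ} (hm : m ∣ m') (hn : n ∣ n') :
    Nat.gcd m n ∣ Nat.gcd m' n' :=
  Nat.dvd_gcd ((Nat.gcd_dvd_left m n).trans hm) ((Nat.gcd_dvd_right m n).trans hn)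

/-- Solves the count for `S`: `n`, `N`, `M` stand for the sizes of `X`, `Y`, `Y ∩ F_q`, while `s`
and `t` are the parity corrections. -/
theorem cast_eq_of_two_mul_eq {S n N M a b c d s t u : ℕ}
    (hcard : 2 * S + 2 * n = n * (n + 1) + N + M)
    (hn : 2 * n = a + b + s) (hN : 2 * N = c + d + t) (hM : 2 * M = u) :
    (S : ℚ) = ((a + b + s) ^ 2 / 4 - (a + b + s) / 2) / 2 + (c + d + t + u) / 4 := by
  have hn' : (n : ℚ) = (a + b + s) / 2 := by
    rw [eq_div_iff two_ne_zero, mul_comm]; exact_mod_cast hn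
  have hN' : (N : ℚ) = (c + d + t) / 2 := by
    rw [eq_div_iff two_ne_zero, mul_comm]; exact_mod_cast hN
  have hM' : (M : ℚ) = u / 2 := by
    rw [eq_div_iff two_ne_zero, mul_comm]; exact_mod_cast hM
  have hS : (2 * S + 2 * n : ℚ) = n * (n + 1) + N + M := by exact_mod_cast hcard
  rw [hn', hN', hM'] at hS
  linear_combination hS / 2

theorem theorem2 (F : Type*) [Field F] [Fintype F] (q : ℕ) (hq : Fintype.card F = q)
    (k : ℕ) (hk : 1 ≤ k) (a b c d : ℕ)
    (ha : a = (q - 1) / Nat.gcd (q - 1) k)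
    (hb : b = (q + 1) / Nat.gcd (q + 1) k)
    (hc : c = (q ^ 2 - 1) / Nat.gcd (q ^ 2 - 1) k)
    (hd : d = (q ^ 2 + 1) / Nat.gcd (q ^ 2 + 1) k) :
    ((Set.range (FoldingB2.inducedMap F (FoldingB2.foldingPoly k))).ncard : ℚ) =
      ((a : ℚ) + b) ^ 2 / 8 + ((c : ℚ) + d) / 4 +
        (if ¬ 2 ∣ k ∨ ¬ 2 ∣ c then (0 : ℚ)
          else if 2 ∣ a * b then ((a : ℚ) + b) / 2 + 1 / 8
          else ((a : ℚ) + b) / 4 + 1 / 4) := by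
  have hq2 : 2 ≤ q := hq ▸ Fintype.one_lt_card
  obtain ⟨hca, hcb, hodd, hkd, hc2, hab, hg, hg'⟩ := quotient_gcd_arith hq2 hk ha hb hc hd
  let K := AlgebraicClosure F
  have hadd (x y : K) : (x + y) ^ q = x ^ q + y ^ q := by
    subst hq; exact add_pow_card_of_algebra (F := F) x y
  have hadd2 (x y : K) : (x + y) ^ q ^ 2 = x ^ q ^ 2 + y ^ q ^ 2 := by
    simp only [pow_two q, pow_mul, hadd]
  have hqK : (q : K) = 0 := by
    have h := congrArg (algebraMap F K) (FiniteField.cast_card_eq_zero F)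
    rwa [hq, map_natCast, map_zero] at h
  have hq4 : 2 ≤ q ^ 2 := hq2.trans (Nat.le_self_pow two_ne_zero q)
  -- As `q` vanishes in `K`, the numbers `q ± 1`, `q ^ 2 ± 1` and all their divisors are nonzero
  -- there, so each of these orders has its full number of roots of unity.
  have hsub (Q : ℕ) (hQ : 2 ≤ Q) (h : (Q : K) = 0) : ((Q - 1 : ℕ) : K) ≠ 0 := by
    rw [Nat.cast_sub (by omega), h, Nat.cast_one, zero_sub]
    exact neg_ne_zero.2 one_ne_zero
  have hsucc (Q : ℕ) (h : (Q : K) = 0) : ((Q + 1 : ℕ) : K) ≠ 0 := by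
    rw [Nat.cast_add, h, Nat.cast_one, zero_add]
    exact one_ne_zero
  have hq2K : ((q ^ 2 : ℕ) : K) = 0 := by rw [Nat.cast_pow, hqK, zero_pow two_ne_zero]
  have da : a ∣ q - 1 := ha ▸ Nat.div_dvd_of_dvd (Nat.gcd_dvd_left _ _)
  have db : b ∣ q + 1 := hb ▸ Nat.div_dvd_of_dvd (Nat.gcd_dvd_left _ _)
  have dc : c ∣ q ^ 2 - 1 := hc ▸ Nat.div_dvd_of_dvd (Nat.gcd_dvd_left _ _)
  have dd : d ∣ q ^ 2 + 1 := hd ▸ Nat.div_dvd_of_dvd (Nat.gcd_dvd_left _ _)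
  have ka := natCast_ne_zero_of_dvd da (hsub q hq2 hqK)
  have kb := natCast_ne_zero_of_dvd db (hsucc q hqK)
  have kc := natCast_ne_zero_of_dvd dc (hsub _ hq4 hq2K)
  have kd := natCast_ne_zero_of_dvd dd (hsucc _ hq2K)
  have pa : 0 < a := Nat.pos_of_dvd_of_pos da (by omega)
  have pb : 0 < b := Nat.pos_of_dvd_of_pos db (by omega)
  have pc : 0 < c := Nat.pos_of_dvd_of_pos dc (by omega)
  have pd : 0 < d := Nat.pos_of_dvd_of_pos dd (by omega)
  have hX := dickson_image_rootTraces (K := K) (by omega : 0 < q - 1) (by omega : 0 < q + 1) k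
  rw [← setOf_pow_eq_self_eq_rootTraces hq2 hadd, ← ha, ← hb] at hX
  have hY := dickson_image_rootTraces (K := K) (by omega : 0 < q ^ 2 - 1)
    (by omega : 0 < q ^ 2 + 1) k
  rw [← setOf_pow_eq_self_eq_rootTraces hq4 hadd2, ← hc, ← hd] at hY
  have hcard := FoldingB2.ncard_range_inducedMap_foldingPoly (F := F) (K := K) k
    (hq.symm ▸ hX.symm) (hq.symm ▸ hY.symm) (finite_rootTraces pa pb) (finite_rootTraces pc pd)
  -- This gcd divides `gcd(q ^ 2 - 1, q ^ 2 + 1)`, hence `2`; if it is `2` then `d` is even, which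
  -- forces `c` to be even.
  have hgd (j : ℕ) (hj : j ∣ q ^ 2 - 1) : Nat.gcd d j ∣ c := by
    have h2 : Nat.gcd d j ∣ 2 := by
      refine (gcd_dvd_gcd_of_dvd dd hj).trans ?_
      rwa [Nat.gcd_comm]
    rcases (Nat.dvd_prime Nat.prime_two).1 h2 with h | h
    · rw [h]; exact one_dvd c
    · have h2d : 2 ∣ d := h ▸ Nat.gcd_dvd_left d j
      rw [h]
      by_contra hcon
      exact (hc2 hcon).2.2 h2d
  have hfac : q ^ 2 - 1 = (q + 1) * (q - 1) := Nat.sq_sub_sq q 1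
  rw [hq, rootTraces_inter_setOf_pow_eq_self (by omega) hadd pc pd
    (hgd _ (hfac ▸ Dvd.intro_left _ rfl)) (hgd _ (hfac ▸ Dvd.intro _ rfl))] at hcard
  have cn := two_mul_ncard_rootTraces ka kb ((gcd_dvd_gcd_of_dvd da db).trans hg)
  have cN := two_mul_ncard_rootTraces kc kd ((gcd_dvd_gcd_of_dvd dc dd).trans hg')
  have cM := two_mul_ncard_rootTraces (K := K)
    (natCast_ne_zero_of_dvd (Nat.gcd_dvd_left c (q - 1)) kc)
    (natCast_ne_zero_of_dvd (Nat.gcd_dvd_left c (q + 1)) kc)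
    ((gcd_dvd_gcd_of_dvd (Nat.gcd_dvd_right c (q - 1)) (Nat.gcd_dvd_right c (q + 1))).trans hg)
  rw [hca, hcb] at cM hcard
  have hdvd : 2 ∣ a * b ↔ 2 ∣ a ∨ 2 ∣ b := Nat.prime_two.dvd_mul
  simp only [hdvd]
  by_cases hk2 : 2 ∣ k
  · by_cases hcc : 2 ∣ c
    · have hdd := hkd hk2
      have hnab := hab hk2
      rw [if_neg (by simp [hk2, hcc] : ¬ (¬ 2 ∣ k ∨ ¬ 2 ∣ c))]
      rw [if_neg (by simp [hcc, hdd])] at cN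
      simp only [hk2, hcc, and_self, if_true, dvd_mul_right] at cM hcard
      by_cases h : 2 ∣ a ∨ 2 ∣ b
      · rw [if_pos h]
        rw [if_neg fun e => h.elim (fun x => hnab ⟨x, e.1 x⟩) fun x => hnab ⟨e.2 x, x⟩] at cn
        rw [cast_eq_of_two_mul_eq hcard cn cN cM]
        push_cast
        ring
      · rw [if_neg h]
        rw [if_pos (iff_of_false (fun x => h (Or.inl x)) fun x => h (Or.inr x))] at cn
        rw [cast_eq_of_two_mul_eq hcard cn cN cM]
        push_cast
        ring
    · obtain ⟨haa, hbb, hdd⟩ := hc2 hcc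
      rw [if_pos (Or.inr hcc)]
      rw [if_pos (iff_of_false haa hbb)] at cn
      rw [if_pos (iff_of_false hcc hdd)] at cN
      simp only [hcc, and_false, if_false, haa, hbb, if_true] at cM hcard
      rw [cast_eq_of_two_mul_eq hcard cn cN cM]
      push_cast
      ring
  · obtain ⟨h₁, h₂⟩ := hodd hk2
    rw [if_pos (Or.inl hk2)]
    rw [if_pos h₁] at cn
    rw [if_pos h₂] at cN
    simp only [hk2, false_and, if_false, h₁, if_true] at cM hcard
    rw [cast_eq_of_two_mul_eq hcard cn cN cM]
    push_cast
    ring
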